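/- Let $3\le r\le 8$ and let $S_r$ be a del Pezzo surface obtained by blowing up $\mathbb P^2$ in $r$ points in general position, so that $\operatorname{Pic} S_r=\mathbb Z h\oplus\mathbb Z e_1\oplus\dots\oplus\mathbb Z e_r$ with $h^2=1$, $h\cdot e_i=0$, $e_i\cdot e_j=-\delta_{ij}$ and canonical class $K=-3h+e_1+\dots+e_r$. A line is a class $l\in\operatorname{Pic} S_r$ with $l^2=l\cdot K=-1$; two distinct lines $l,l'$ are disjoint (skew) if $l\cdot l'=0$; a skew $a$-line is a class of the form $l_1+\dots+l_a$ with $l_1,\dots,l_a$ pairwise disjoint lines. Let $W$ be the group generated by the reflections $D\mapsto D+(D\cdot d)\,d$ of $\operatorname{Pic} S_r\otimes\mathbb Q$ in the simple roots $d=h-e_1-e_2-e_3$ and $d=e_i-e_{i+1}$ ($1\le i\le r-1$), and let the Gosset polytope $(r-4)_{21}\subset\operatorname{Pic} S_r\otimes\mathbb Q$ be the convex hull of the orbit $W\cdot e_r$. Then: 1. The vertices of $(r-4)_{21}$ are exactly the lines. 2. For distinct lines $l_1,l_2$, the corresponding vertices of $(r-4)_{21}$ are joined by an edge if and only if $l_1\cdot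 l_2=0$. 3. For every $1\le a\le r$, the faces of $(r-4)_{21}$ that are $(a-1)$-simplexes are regular simplexes, with $(u-v)^2=-2$ for any two distinct vertices $u,v$ of such a face; distinct such faces have distinct vertex sums; and sending an $(a-1)$-simplex face to the sum of its vertices is a bijection from the set of these faces onto the set of skew $a$-lines in $\operatorname{Pic} S_r$. -/

import Mathlib

namespace DelPezzo

/-- The lattice `R h ⊕ R e₁ ⊕ ⋯ ⊕ R e_r`: coordinate `0` is the coefficient of `h`, the class of
the pullback of a line of `ℙ²`, and coordinate `i.succ` is the coefficient of the exceptional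
class `e i` of the blow-up of `ℙ²` in `r` points. -/
abbrev PicCoeff (R : Type) (r : ℕ) : Type := Fin (r + 1) → R

/-- The Picard group `Pic S_r = ℤ h ⊕ ℤ e₁ ⊕ ⋯ ⊕ ℤ e_r`. -/
abbrev Pic (r : ℕ) : Type := PicCoeff ℤ r

/-- `Pic S_r ⊗ ℚ = ℚ h ⊕ ℚ e₁ ⊕ ⋯ ⊕ ℚ e_r`. -/
abbrev PicQ (r : ℕ) : Type := PicCoeff ℚ r

/-- The intersection pairing: `h² = 1`, `h · eᵢ = 0`, `eᵢ · eⱼ = -δᵢⱼ`, extended bilinearly. -/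
def inter {R : Type} [CommRing R] {r : ℕ} (x y : PicCoeff R r) : R :=
  x 0 * y 0 - ∑ i : Fin r, x i.succ * y i.succ

/-- The class `h`. -/
def h (r : ℕ) : Pic r := Pi.single 0 1

/-- The exceptional class `e i`. -/
def e {r : ℕ} (i : Fin r) : Pic r := Pi.single i.succ 1

/-- The canonical class `K = -3h + e₁ + ⋯ + e_r`. -/
def K (r : ℕ) : Pic r := (-3 : ℤ) • h r + ∑ i : Fin r, e i

/-- The inclusion `Pic S_r → Pic S_r ⊗ ℚ`. -/
def toQ {r : ℕ} (D : Pic r) : PicQ r := fun i => (D i : ℚ)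

/-- The set `L_r` of lines: classes `l` with `l² = l · K = -1`. -/
def lines (r : ℕ) : Set (Pic r) := {l | inter l l = -1 ∧ inter l (K r) = -1}

/-- The set `L_r^a` of skew `a`-lines: sums of `a` pairwise disjoint lines. (Lines `l`, `l'` with
`l · l' = 0` are automatically distinct, because `l · l = -1`.) -/
def skewLines (r a : ℕ) : Set (Pic r) :=
  {D | ∃ l : Fin a → Pic r, (∀ i, l i ∈ lines r) ∧
    (∀ i j, i ≠ j → inter (l i) (l j) = 0) ∧ D = ∑ i, l i}

/-- The simple roots `h - e₁ - e₂ - e₃` and `eᵢ - eᵢ₊₁`, `1 ≤ i ≤ r - 1`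
(the index set `Fin r` starts at `0`). -/
def simpleRoots (r : ℕ) : Set (Pic r) :=
  {d | (∃ i j k : Fin r, (i : ℕ) = 0 ∧ (j : ℕ) = 1 ∧ (k : ℕ) = 2 ∧ d = h r - e i - e j - e k) ∨
    (∃ i j : Fin r, (j : ℕ) = (i : ℕ) + 1 ∧ d = e i - e j)}

/-- The Weyl group `W(S_r)` on `Pic S_r ⊗ ℚ`, generated by the reflections
`D ↦ D + (D · d) d` in the simple roots `d`. -/
def weylGroup (r : ℕ) : Subgroup (PicQ r ≃ₗ[ℚ] PicQ r) :=
  Subgroup.closure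
    {g | ∃ d ∈ simpleRoots r, ∀ D : PicQ r, g D = D + inter D (toQ d) • toQ d}

/-- The Gosset polytope `(r-4)_{21}` in `Pic S_r ⊗ ℚ`, by Wythoff's construction: the convex hull
of the Weyl group orbit of the last exceptional class `e_r`. -/
def gosset (r : ℕ) : Set (PicQ r) :=
  convexHull ℚ {x | ∃ w ∈ weylGroup r, ∃ i : Fin r, (i : ℕ) + 1 = r ∧ x = w (toQ (e i))}

/-- `F` is a nonempty face of `P`: the set of points of `P` where some linear functional attains
its maximum over `P`. -/
def IsFace {r : ℕ} (P F : Set (PicQ r)) : Prop :=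
  F.Nonempty ∧ ∃ (φ : Module.Dual ℚ (PicQ r)) (c : ℚ),
    (∀ x ∈ P, φ x ≤ c) ∧ F = {x | x ∈ P ∧ φ x = c}

/-- The faces of `(r-4)_{21}` that are simplexes with `a` vertices, i.e. `(a-1)`-simplexes. -/
def simplexFaces (r a : ℕ) : Set (Set (PicQ r)) :=
  {F | IsFace (gosset r) F ∧
    ∃ v : Fin a → PicQ r, AffineIndependent ℚ v ∧ F = convexHull ℚ (Set.range v)}

/-- The sum of the vertices (extreme points) of a polytope. -/
noncomputable def vertexSum {r : ℕ} (F : Set (PicQ r)) : PicQ r :=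
  ∑ᶠ v ∈ F.extremePoints ℚ, v

end DelPezzo

/-! For `r ≤ 8` the pairing is negative definite on the orthogonal complement of `K`, so distinct
lines meet nonnegatively. Hence a sum `D` of pairwise skew lines satisfies `D · x = -1` when `x` is
a summand and `D · x ≥ 0` when `x` is any other line. The functional `-(D · _)` therefore cuts out
of the polytope exactly the simplex on the summands (`isFace_convexHull_of_skew`), and `D`
determines its summands (`mem_range_iff_inter_sum`).

Conversely, if two vertices of a face satisfy `l₁ · l₂ > 0`, then `l₁ + l₂` is also the sum of two
other lines (`exists_add_eq_add`). The face must contain these as well, which is impossible in a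
simplex.

This exchange, and the fact that the lines form the orbit of `e_r` (`gosset_eq`), both come from
reflecting a class into the dominant chamber (`dominant_induction`), where inequalities leave only a
few numerical possibilities. -/

namespace DelPezzo

/-! ### The intersection pairing and reflections -/

section Pairing

variable {R : Type} [CommRing R] {r : ℕ}

theorem inter_comm (x y : PicCoeff R r) : inter x y = inter y x := by
  simp only [inter, mul_comm]

theorem inter_add_left (x y z : PicCoeff R r) : inter (x + y) z = inter x z + inter y z := by
  simp only [inter, Pi.add_apply, add_mul, Finset.sum_add_distrib]; ring

theorem inter_smul_left (c : R) (x y : PicCoeff R r) : inter (c • x) y = c * inter x y := by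
  simp only [inter, Pi.smul_apply, smul_eq_mul, mul_sub, Finset.mul_sum, mul_assoc]

theorem inter_add_right (x y z : PicCoeff R r) : inter x (y + z) = inter x y + inter x z := by
  rw [inter_comm, inter_add_left, inter_comm y, inter_comm z]

theorem inter_smul_right (c : R) (x y : PicCoeff R r) : inter x (c • y) = c * inter x y := by
  rw [inter_comm, inter_smul_left, inter_comm]

theorem inter_sub_left (x y z : PicCoeff R r) : inter (x - y) z = inter x z - inter y z := by
  have := inter_add_left (x - y) y z
  rw [sub_add_cancel] at this
  rw [this]; ring

theorem inter_sub_right (x y z : PicCoeff R r) : inter x (y - z) = inter x y - inter x z := by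
  rw [inter_comm, inter_sub_left, inter_comm y, inter_comm z]

/-- The intersection pairing as a linear functional of its first argument. -/
def interLeft (y : PicCoeff R r) : PicCoeff R r →ₗ[R] R where
  toFun x := inter x y
  map_add' x x' := inter_add_left x x' y
  map_smul' c x := inter_smul_left c x y

theorem interLeft_apply (x y : PicCoeff R r) : interLeft y x = inter x y := rfl

theorem inter_sum_left {ι : Type*} (s : Finset ι) (f : ι → PicCoeff R r) (y : PicCoeff R r) :
    inter (∑ i ∈ s, f i) y = ∑ i ∈ s, inter (f i) y :=
  map_sum (interLeft y) f s

theorem inter_sum_right {ι : Type*} (s : Finset ι) (f : ι → PicCoeff R r) (y : PicCoeff R r) :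
    inter y (∑ i ∈ s, f i) = ∑ i ∈ s, inter y (f i) := by
  rw [inter_comm, inter_sum_left]
  simp only [inter_comm]

/-- The reflection `D ↦ D + (D · d) d`. -/
def refl (d D : PicCoeff R r) : PicCoeff R r := D + inter D d • d

theorem inter_refl_left {d : PicCoeff R r} (x y : PicCoeff R r) :
    inter (refl d x) y = inter x y + inter x d * inter y d := by
  rw [refl, inter_add_left, inter_smul_left, inter_comm d y]

theorem refl_refl {d : PicCoeff R r} (hd : inter d d = -2) (x : PicCoeff R r) :
    refl d (refl d x) = x := by
  rw [refl, inter_refl_left, hd, refl]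
  ext i
  simp only [Pi.add_apply, Pi.smul_apply, smul_eq_mul]
  ring

theorem inter_refl_refl {d : PicCoeff R r} (hd : inter d d = -2) (x y : PicCoeff R r) :
    inter (refl d x) (refl d y) = inter x y := by
  rw [inter_refl_left, inter_comm x, inter_refl_left, inter_refl_left, hd, inter_comm y x]
  ring

theorem inter_refl_comm {d : PicCoeff R r} (hd : inter d d = -2) (x y : PicCoeff R r) :
    inter (refl d x) y = inter x (refl d y) := by
  rw [← inter_refl_refl hd x, refl_refl hd]

end Pairing

variable {r : ℕ}

/-! ### Passage to `ℚ`, lines and simple roots -/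

theorem toQ_add (x y : Pic r) : toQ (x + y) = toQ x + toQ y := by
  ext i; simp [toQ]

theorem toQ_sum {ι : Type*} (s : Finset ι) (f : ι → Pic r) :
    toQ (∑ i ∈ s, f i) = ∑ i ∈ s, toQ (f i) := by
  ext i; simp [toQ]

theorem toQ_injective : Function.Injective (toQ : Pic r → PicQ r) := fun x y hxy => by
  ext i
  have := congrFun hxy i
  simpa [toQ] using this

theorem inter_toQ (x y : Pic r) : inter (toQ x) (toQ y) = ((inter x y : ℤ) : ℚ) := by
  simp [inter, toQ]

theorem toQ_refl (d x : Pic r) : toQ (refl d x) = refl (toQ d) (toQ x) := by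
  rw [refl, refl, inter_toQ]
  ext i; simp [toQ]

theorem inter_h (x : Pic r) : inter x (h r) = x 0 := by
  simp [inter, h]

theorem inter_e (x : Pic r) (i : Fin r) : inter x (e i) = -x i.succ := by
  simp [inter, e, Pi.single_apply]

theorem inter_h_h : inter (h r) (h r) = 1 := by
  rw [inter_h]; simp [h]

theorem inter_h_e (i : Fin r) : inter (h r) (e i) = 0 := by
  rw [inter_e]; simp [h]

theorem inter_e_h (i : Fin r) : inter (e i) (h r) = 0 := by
  rw [inter_comm, inter_h_e]

theorem inter_e_e (i j : Fin r) : inter (e i) (e j) = if i = j then -1 else 0 := by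
  rw [inter_e]
  by_cases hij : i = j
  · simp [e, hij]
  · simp [e, hij, Ne.symm hij]

theorem inter_K (x : Pic r) : inter x (K r) = -3 * inter x (h r) + ∑ i, inter x (e i) := by
  rw [K, inter_add_right, inter_smul_right, inter_sum_right]

theorem inter_e_K (i : Fin r) : inter (e i) (K r) = -1 := by
  rw [inter_K, inter_e_h]; simp [inter_e_e]

theorem inter_h_K : inter (h r) (K r) = -3 := by
  rw [inter_K, inter_h_h]; simp [inter_h_e]

theorem inter_self_eq (x : Pic r) :
    inter x x = inter x (h r) ^ 2 - ∑ i, inter x (e i) ^ 2 := by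
  simp only [inter_h, inter_e, neg_sq]
  simp only [inter, sq]

theorem e_mem_lines (i : Fin r) : e i ∈ lines r :=
  ⟨by simp [inter_e_e], inter_e_K i⟩

theorem inter_self_of_mem_simpleRoots {d : Pic r} (hd : d ∈ simpleRoots r) : inter d d = -2 := by
  rcases hd with ⟨i, j, k, hi, hj, hk, rfl⟩ | ⟨i, j, hij, rfl⟩
  · have h1 : i ≠ j := fun hh => by rw [hh] at hi; omega
    have h2 : i ≠ k := fun hh => by rw [hh] at hi; omega
    have h3 : j ≠ k := fun hh => by rw [hh] at hj; omega
    simp [inter_sub_left, inter_sub_right, inter_h_h, inter_h_e, inter_e_h, inter_e_e, h1, h2, h3,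
      h1.symm, h2.symm, h3.symm]
  · have h1 : i ≠ j := fun hh => by rw [hh] at hij; omega
    simp [inter_sub_left, inter_sub_right, inter_e_e, h1, h1.symm]

theorem inter_K_of_mem_simpleRoots {d : Pic r} (hd : d ∈ simpleRoots r) : inter d (K r) = 0 := by
  rcases hd with ⟨i, j, k, hi, hj, hk, rfl⟩ | ⟨i, j, hij, rfl⟩ <;>
    simp [inter_sub_left, inter_e_K, inter_h_K]

theorem inter_refl_K {d : Pic r} (hd : d ∈ simpleRoots r) (x : Pic r) :
    inter (refl d x) (K r) = inter x (K r) := by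
  rw [inter_refl_left, inter_comm (K r), inter_K_of_mem_simpleRoots hd, mul_zero, add_zero]

theorem refl_mem_lines {d l : Pic r} (hd : d ∈ simpleRoots r) (hl : l ∈ lines r) :
    refl d l ∈ lines r := by
  refine ⟨?_, ?_⟩
  · rw [inter_refl_refl (inter_self_of_mem_simpleRoots hd)]; exact hl.1
  · rw [inter_refl_K hd]; exact hl.2

/-! ### Descent to the dominant chamber -/

/-- The height of a class, a linear function positive on the simple roots. -/
def height (D : Pic r) : ℤ := ∑ i : Fin r, (i : ℤ) * inter D (e i)

theorem height_refl (d D : Pic r) : height (refl d D) = height D + inter D d * height d := by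
  simp only [height, inter_refl_left, Finset.mul_sum, ← Finset.sum_add_distrib]
  refine Finset.sum_congr rfl fun i _ => ?_
  rw [inter_comm d]; ring

theorem height_pos {d : Pic r} (hd : d ∈ simpleRoots r) : 0 < height d := by
  rcases hd with ⟨i, j, k, hi, hj, hk, rfl⟩ | ⟨i, j, hij, rfl⟩
  · simp [height, inter_sub_left, inter_h_e, inter_e_e, mul_sub, Finset.sum_sub_distrib, hi, hj, hk]
  · simp [height, inter_sub_left, inter_e_e, mul_sub, Finset.sum_sub_distrib, hij]

/-- Reflecting in simple roots moves any class that is bounded below on the lines into the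
dominant chamber. -/
theorem dominant_induction {P : Pic r → Prop}
    (dominant : ∀ D : Pic r, (∀ l ∈ lines r, -1 ≤ inter D l) →
      (∀ d ∈ simpleRoots r, 0 ≤ inter D d) → P D)
    (step : ∀ D, ∀ d ∈ simpleRoots r, P (refl d D) → P D)
    (D : Pic r) (hD : ∀ l ∈ lines r, -1 ≤ inter D l) : P D := by
  have bound : ∀ D : Pic r, (∀ l ∈ lines r, -1 ≤ inter D l) →
      0 ≤ height D + ∑ i : Fin r, (i : ℤ) := by
    intro D hD
    rw [height, ← Finset.sum_add_distrib]
    refine Finset.sum_nonneg fun i _ => ?_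
    have := hD _ (e_mem_lines i)
    have hi : (0 : ℤ) ≤ (i : ℤ) := by positivity
    nlinarith
  induction hn : (height D + ∑ i : Fin r, (i : ℤ)).toNat using Nat.strong_induction_on
    generalizing D with
  | _ n ih =>
    by_cases hdom : ∀ d ∈ simpleRoots r, 0 ≤ inter D d
    · exact dominant D hD hdom
    -- Reflecting in a simple root with `D · d < 0` strictly lowers the height and keeps the lower
    -- bound on lines, since reflections preserve the set of lines.
    · push Not at hdom
      obtain ⟨d, hd, hneg⟩ := hdom
      have hD' : ∀ l ∈ lines r, -1 ≤ inter (refl d D) l := fun l hl => by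
        rw [inter_refl_comm (inter_self_of_mem_simpleRoots hd)]
        exact hD _ (refl_mem_lines hd hl)
      refine step D d hd (ih _ ?_ (refl d D) hD' rfl)
      have h1 := bound _ hD'
      have h2 := bound _ hD
      have h3 := height_refl d D
      have h4 := mul_neg_of_neg_of_pos hneg (height_pos hd)
      omega

/-! ### Negative definiteness and pairs of lines -/

/-- The intersection form is negative definite on the orthogonal complement of `K`. -/
theorem eq_zero_of_inter_self_nonneg (hr : r ≤ 8) {x : Pic r} (hK : inter x (K r) = 0)
    (hx : 0 ≤ inter x x) : x = 0 := by
  rw [inter_K] at hK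
  rw [inter_self_eq] at hx
  have hc := sq_sum_le_card_mul_sum_sq (s := Finset.univ) (f := fun i : Fin r => inter x (e i))
  rw [Finset.card_univ, Fintype.card_fin] at hc
  have hs : ∑ i, inter x (e i) = 3 * inter x (h r) := by linarith
  rw [hs] at hc
  have hr' : (r : ℤ) ≤ 8 := by exact_mod_cast hr
  have hpos : 0 ≤ ∑ i, inter x (e i) ^ 2 := Finset.sum_nonneg fun i _ => sq_nonneg _
  -- With `S` the sum of squares, Cauchy–Schwarz gives `9 (x · h)² ≤ 8 S`, while `hx` says `S ≤ (x ·
  -- h)²`.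
  have hzero : ∑ i, inter x (e i) ^ 2 = 0 := by nlinarith
  have h0 : inter x (h r) = 0 := by
    rw [hzero] at hc
    exact pow_eq_zero_iff two_ne_zero |>.1 (le_antisymm (by linarith) (sq_nonneg _))
  rw [Finset.sum_eq_zero_iff_of_nonneg fun i _ => sq_nonneg _] at hzero
  ext i
  refine Fin.cases ?_ (fun i => ?_) i
  · rw [← inter_h x, h0]; rfl
  · have := hzero i (Finset.mem_univ _)
    rw [inter_e] at this
    simpa using this

/-- The difference is orthogonal to `K` and has square `-2 - 2 (l · l')`, which would be nonnegative
if `l · l' ≤ -1`. -/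
theorem inter_nonneg_of_ne (hr : r ≤ 8) {l l' : Pic r} (hl : l ∈ lines r) (hl' : l' ∈ lines r)
    (hne : l ≠ l') : 0 ≤ inter l l' := by
  by_contra hneg
  refine hne (sub_eq_zero.1 (eq_zero_of_inter_self_nonneg hr ?_ ?_))
  · rw [inter_sub_left, hl.2, hl'.2, sub_self]
  · rw [inter_sub_left, inter_sub_right, inter_sub_right, hl.1, hl'.1, inter_comm l']
    omega

theorem neg_one_le_inter (hr : r ≤ 8) {l l' : Pic r} (hl : l ∈ lines r) (hl' : l' ∈ lines r) :
    -1 ≤ inter l l' := by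
  by_cases hne : l = l'
  · subst hne; exact hl.1.ge
  · exact le_trans (by norm_num) (inter_nonneg_of_ne hr hl hl' hne)

/-! ### Dominant classes of small degree -/

/-- The numerical constraints on a dominant class with nonnegative multiplicities: `d` is the
coefficient of `h`, `a ≥ b ≥ g` are the three largest multiplicities, and `T`, `Q` are the sum and
the sum of squares of the others. -/
theorem exists_dominant_numbers (hr3 : 3 ≤ r) (hr : r ≤ 8) {D : Pic r}
    (hdom : ∀ d ∈ simpleRoots r, 0 ≤ inter D d) (hm : ∀ i, 0 ≤ inter D (e i)) :
    ∃ d a b g T Q : ℤ, inter D (e ⟨1, by omega⟩) = b ∧ inter D (e ⟨2, by omega⟩) = g ∧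
      b ≤ a ∧ g ≤ b ∧ 0 ≤ g ∧ a + b + g ≤ d ∧ T ≤ 5 * g ∧ T ^ 2 ≤ 5 * Q ∧ Q ≤ g * T ∧
      0 ≤ T ∧ inter D (K r) = a + b + g + T - 3 * d ∧
      inter D D = d ^ 2 - (a ^ 2 + b ^ 2 + g ^ 2 + Q) := by
  obtain ⟨n, rfl⟩ := Nat.exists_eq_add_of_le' hr3
  have hstep : ∀ i j : Fin (n + 3), (j : ℕ) = i + 1 → inter D (e j) ≤ inter D (e i) := by
    intro i j hij
    have := hdom (e i - e j) (Or.inr ⟨i, j, hij, rfl⟩)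
    rw [inter_sub_right] at this
    linarith
  have hcrem := hdom (h _ - e 0 - e 1 - e 2) (Or.inl ⟨0, 1, 2, rfl, rfl, rfl, rfl⟩)
  rw [inter_sub_right, inter_sub_right, inter_sub_right] at hcrem
  have hle : ∀ k : ℕ, ∀ hk : k + 2 < n + 3, inter D (e ⟨k + 2, hk⟩) ≤ inter D (e 2) := by
    intro k
    induction k with
    | zero => intro hk; exact le_rfl
    | succ k ih => intro hk; exact (hstep ⟨k + 2, by omega⟩ _ rfl).trans (ih _)
  have htail : ∀ i : Fin n, inter D (e i.succ.succ.succ) ≤ inter D (e 2) := fun i =>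
    hle (i + 1) (by omega)
  have hsum : ∀ f : Fin (n + 3) → ℤ,
      ∑ i, f i = f 0 + (f 1 + (f 2 + ∑ i : Fin n, f i.succ.succ.succ)) := fun f => by
    rw [Fin.sum_univ_succ, Fin.sum_univ_succ, Fin.sum_univ_succ]; rfl
  -- At most `8 - 3` multiplicities remain beyond the three largest; this is the source of every
  -- constant `5`.
  have hn : (n : ℤ) ≤ 5 := by omega
  have hg := hm 2
  have hc := sq_sum_le_card_mul_sum_sq (s := Finset.univ)
    (f := fun i : Fin n => inter D (e i.succ.succ.succ))
  rw [Finset.card_univ, Fintype.card_fin] at hc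
  refine ⟨inter D (h _), inter D (e 0), inter D (e 1), inter D (e 2),
    ∑ i : Fin n, inter D (e i.succ.succ.succ), ∑ i : Fin n, inter D (e i.succ.succ.succ) ^ 2,
    rfl, rfl, hstep 0 1 rfl, hstep 1 2 rfl, hg, by linarith, ?_, ?_, ?_,
    Finset.sum_nonneg fun i _ => hm _, ?_, ?_⟩
  · calc _ ≤ ∑ i : Fin n, inter D (e 2) := Finset.sum_le_sum fun i _ => htail i
      _ = n * inter D (e 2) := by simp
      _ ≤ _ := mul_le_mul_of_nonneg_right hn hg
  · exact hc.trans (mul_le_mul_of_nonneg_right hn (Finset.sum_nonneg fun i _ => sq_nonneg _))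
  · rw [Finset.mul_sum]
    refine Finset.sum_le_sum fun i _ => ?_
    rw [sq]
    exact mul_le_mul_of_nonneg_right (htail i) (hm _)
  · rw [inter_K, hsum]; ring
  · rw [inter_self_eq, hsum]; ring

/-- With nonnegative multiplicities, `l · K = -1` leaves only `3h - e₁ - ⋯ - e₈`, which is `-K` for
`r = 8` and has square `1` instead of `-1`. -/
theorem exists_inter_e_neg_of_dominant (hr3 : 3 ≤ r) (hr : r ≤ 8) {l : Pic r} (hl : l ∈ lines r)
    (hdom : ∀ d ∈ simpleRoots r, 0 ≤ inter l d) : ∃ i, inter l (e i) < 0 := by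
  by_contra! hm
  obtain ⟨d, a, b, g, T, Q, -, -, hba, hgb, hg, hd, hT, hTQ, hQ, hT0, hK, hsq⟩ :=
    exists_dominant_numbers hr3 hr hdom hm
  rw [hl.1] at hsq
  rw [hl.2] at hK
  -- The degree condition gives `2d ≤ T + 1 ≤ 5g + 1`, whereas `3g ≤ a + b + g ≤ d`.
  have hg1 : g ≤ 1 := by omega
  obtain rfl | rfl : g = 0 ∨ g = 1 := by omega
  · omega
  · obtain rfl : d = 3 := by omega
    obtain rfl : a = 1 := by omega
    obtain rfl : b = 1 := by omega
    obtain rfl : T = 5 := by omega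
    omega

/-- The only candidates are `h - e₁`, `3h` minus seven of the `eᵢ`, and `6h - 2(e₁ + ⋯ + e₈)`, with
`k = 1, 2, 3`. The second and third multiplicities are `k - 1` in each case; the first is not for `h
- e₁`. -/
theorem inter_e_of_dominant_of_inter_K (hr3 : 3 ≤ r) (hr : r ≤ 8) {D : Pic r} {k : ℤ}
    (hK : inter D (K r) = -2) (hD : inter D D = 2 * k - 2)
    (hdom : ∀ d ∈ simpleRoots r, 0 ≤ inter D d) (hm : ∀ i, 0 ≤ inter D (e i)) :
    inter D (e ⟨1, by omega⟩) = k - 1 ∧ inter D (e ⟨2, by omega⟩) = k - 1 := by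
  obtain ⟨d, a, b, g, T, Q, hb', hg', hba, hgb, hg, hd, hT, hTQ, hQ, hT0, hK', hsq⟩ :=
    exists_dominant_numbers hr3 hr hdom hm
  rw [hD] at hsq
  rw [hK] at hK'
  rw [hb', hg']
  have hg1 : g ≤ 2 := by omega
  obtain rfl | rfl | rfl : g = 0 ∨ g = 1 ∨ g = 2 := by omega
  · obtain rfl : d = 1 := by omega
    obtain rfl : T = 0 := by omega
    obtain rfl : b = 0 := by omega
    obtain rfl : a = 1 := by omega
    omega
  · obtain rfl : d = 3 := by omega
    obtain rfl : a = 1 := by omega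
    obtain rfl : b = 1 := by omega
    obtain rfl : T = 4 := by omega
    omega
  · obtain rfl : d = 6 := by omega
    obtain rfl : a = 2 := by omega
    obtain rfl : b = 2 := by omega
    obtain rfl : T = 10 := by omega
    omega

/-- For dominant `D` the exceptional classes `e₂`, `e₃` work, and reflections carry the pair back.
-/
theorem exists_skew_pair (hr3 : 3 ≤ r) (hr : r ≤ 8) {D : Pic r} {k : ℤ}
    (hpos : ∀ l ∈ lines r, 0 ≤ inter D l)
    (hK : inter D (K r) = -2) (hD : inter D D = 2 * k - 2) :
    ∃ x ∈ lines r, ∃ y ∈ lines r, inter x y = 0 ∧ inter D x = k - 1 ∧ inter D y = k - 1 := by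
  refine dominant_induction (P := fun D => (∀ l ∈ lines r, 0 ≤ inter D l) →
    inter D (K r) = -2 → inter D D = 2 * k - 2 → ∃ x ∈ lines r, ∃ y ∈ lines r,
      inter x y = 0 ∧ inter D x = k - 1 ∧ inter D y = k - 1) ?_ ?_ D ?_ hpos hK hD
  · intro D _ hdom hpos hK hD
    obtain ⟨h1, h2⟩ := inter_e_of_dominant_of_inter_K hr3 hr hK hD hdom
      fun i => hpos _ (e_mem_lines i)
    exact ⟨_, e_mem_lines _, _, e_mem_lines _, by simp [inter_e_e], h1, h2⟩
  · intro D d hd ih hpos hK hD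
    have hdd := inter_self_of_mem_simpleRoots hd
    obtain ⟨x, hx, y, hy, hxy, hDx, hDy⟩ := ih
      (fun l hl => by rw [inter_refl_comm hdd]; exact hpos _ (refl_mem_lines hd hl))
      (by rw [inter_refl_K hd, hK]) (by rw [inter_refl_refl hdd, hD])
    rw [inter_refl_comm hdd] at hDx hDy
    exact ⟨_, refl_mem_lines hd hx, _, refl_mem_lines hd hy,
      by rw [inter_refl_refl hdd, hxy], hDx, hDy⟩
  · intro l hl
    have := hpos l hl
    omega

/-- The sum of two intersecting lines is also the sum of two other lines. -/
theorem exists_add_eq_add (hr3 : 3 ≤ r) (hr : r ≤ 8) {l₁ l₂ : Pic r} (h₁ : l₁ ∈ lines r)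
    (h₂ : l₂ ∈ lines r) (hpos : 0 < inter l₁ l₂) :
    ∃ x ∈ lines r, ∃ y ∈ lines r, x + y = l₁ + l₂ ∧ x ≠ l₁ ∧ x ≠ l₂ ∧ y ≠ l₁ ∧ y ≠ l₂ := by
  have hnonneg : ∀ l ∈ lines r, 0 ≤ inter (l₁ + l₂) l := by
    intro l hl
    rw [inter_add_left]
    by_cases e₁ : l₁ = l
    · subst e₁
      rw [h₁.1, inter_comm]; omega
    by_cases e₂ : l₂ = l
    · subst e₂
      rw [h₂.1]; omega
    exact add_nonneg (inter_nonneg_of_ne hr h₁ hl e₁) (inter_nonneg_of_ne hr h₂ hl e₂)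
  have hsq : inter (l₁ + l₂) (l₁ + l₂) = 2 * inter l₁ l₂ - 2 := by
    rw [inter_add_left, inter_add_right, inter_add_right, h₁.1, h₂.1, inter_comm l₂]; ring
  have hK : inter (l₁ + l₂) (K r) = -2 := by rw [inter_add_left, h₁.2, h₂.2]; norm_num
  obtain ⟨x, hx, y, hy, hxy, hDx, hDy⟩ := exists_skew_pair hr3 hr hnonneg hK hsq
  have hne : x ≠ y := fun hh => by
    rw [hh, hy.1] at hxy; omega
  have hyx := inter_comm x y
  -- Each `lᵢ` also pairs to `k - 1` with `l₁ + l₂`, where `k = l₁ · l₂`, so one candidate might be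
  -- `l₁` or `l₂`. Two distinct skew candidates cannot both be, because `l₁ · l₂ > 0`.
  have key : ∃ z ∈ lines r, inter (l₁ + l₂) z = inter l₁ l₂ - 1 ∧ z ≠ l₁ ∧ z ≠ l₂ := by
    have h21 := inter_comm l₁ l₂
    by_contra! hcon
    have hx' : x = l₁ ∨ x = l₂ := or_iff_not_imp_left.2 (hcon x hx hDx)
    have hy' : y = l₁ ∨ y = l₂ := or_iff_not_imp_left.2 (hcon y hy hDy)
    rcases hx' with rfl | rfl <;> rcases hy' with rfl | rfl <;> first | exact hne rfl | omega
  obtain ⟨z, hz, hDz, hz₁, hz₂⟩ := key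
  -- The value `k - 1` is exactly what gives the complement `l₁ + l₂ - z` square `-1`.
  refine ⟨z, hz, l₁ + l₂ - z, ⟨?_, ?_⟩, by abel, hz₁, hz₂, ?_, ?_⟩
  · rw [inter_sub_left, inter_sub_right, inter_sub_right, hsq, hDz, hz.1, inter_comm z, hDz]
    ring
  · rw [inter_sub_left, hK, hz.2]; norm_num
  · intro hh; exact hz₂ (by rw [sub_eq_iff_eq_add] at hh; exact (add_left_cancel hh).symm)
  · intro hh
    rw [sub_eq_iff_eq_add, add_comm] at hh
    exact hz₁ (add_left_cancel hh).symm

/-! ### The Weyl orbit of the last exceptional class -/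

/-- The reflection in a simple root, as an element of the Weyl group. -/
def reflEquiv (d : PicQ r) (hd : inter d d = -2) : PicQ r ≃ₗ[ℚ] PicQ r :=
  LinearEquiv.ofInvolutive
    (LinearMap.id + (interLeft d).smulRight d) (fun x => refl_refl hd x)

theorem reflEquiv_apply (d : PicQ r) (hd : inter d d = -2) (x : PicQ r) :
    reflEquiv d hd x = refl d x := rfl

theorem weylGroup_map_lines {w : PicQ r ≃ₗ[ℚ] PicQ r} (hw : w ∈ weylGroup r) :
    ∀ l ∈ lines r, ∃ l' ∈ lines r, w (toQ l) = toQ l' := by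
  -- The claim for `w⁻¹` is carried along so that the induction passes through inverses.
  suffices hs : (∀ l ∈ lines r, ∃ l' ∈ lines r, w (toQ l) = toQ l') ∧
      ∀ l ∈ lines r, ∃ l' ∈ lines r, w⁻¹ (toQ l) = toQ l' from hs.1
  induction hw using Subgroup.closure_induction with
  | mem g hg =>
    obtain ⟨d, hd, hg⟩ := hg
    have hg' : ∀ l, g (toQ l) = toQ (refl d l) := fun l => by rw [hg, toQ_refl, refl]
    refine ⟨fun l hl => ⟨_, refl_mem_lines hd hl, hg' l⟩,
      fun l hl => ⟨_, refl_mem_lines hd hl, ?_⟩⟩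
    apply g.injective
    rw [hg', refl_refl (inter_self_of_mem_simpleRoots hd)]
    exact g.apply_symm_apply _
  | one => exact ⟨fun l hl => ⟨l, hl, rfl⟩, fun l hl => ⟨l, hl, rfl⟩⟩
  | mul g g' _ _ hg hg' =>
    refine ⟨fun l hl => ?_, fun l hl => ?_⟩
    · obtain ⟨l', hl', h1⟩ := hg'.1 l hl
      obtain ⟨l'', hl'', h2⟩ := hg.1 l' hl'
      exact ⟨l'', hl'', by rw [LinearEquiv.mul_apply, h1, h2]⟩
    · obtain ⟨l', hl', h1⟩ := hg.2 l hl
      obtain ⟨l'', hl'', h2⟩ := hg'.2 l' hl'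
      exact ⟨l'', hl'', by rw [mul_inv_rev, LinearEquiv.mul_apply, h1, h2]⟩
  | inv g _ hg => exact ⟨hg.2, by rw [inv_inv]; exact hg.1⟩

/-- A dominant line is negative on some `eᵢ`, hence equals it; dominance against `eᵢ - eᵢ₊₁` then
forces `i` to be the last index. -/
theorem exists_weylGroup_of_mem_lines (hr3 : 3 ≤ r) (hr : r ≤ 8) {l : Pic r} (hl : l ∈ lines r) :
    ∃ w ∈ weylGroup r, ∃ i : Fin r, (i : ℕ) + 1 = r ∧ toQ l = w (toQ (e i)) := by
  refine dominant_induction (P := fun l => l ∈ lines r → ∃ w ∈ weylGroup r, ∃ i : Fin r,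
    (i : ℕ) + 1 = r ∧ toQ l = w (toQ (e i))) ?_ ?_ l ?_ hl
  · intro l _ hdom hl
    obtain ⟨i, hi⟩ := exists_inter_e_neg_of_dominant hr3 hr hl hdom
    obtain rfl : l = e i := by
      by_contra hne
      exact absurd (inter_nonneg_of_ne hr hl (e_mem_lines i) hne) (not_le.2 hi)
    refine ⟨1, one_mem _, i, ?_, rfl⟩
    by_contra hlast
    have := hdom (e i - e ⟨i + 1, by omega⟩) (Or.inr ⟨i, _, rfl, rfl⟩)
    rw [inter_sub_right, inter_e_e, inter_e_e, if_pos rfl,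
      if_neg (fun hh => by have := congrArg Fin.val hh; simp at this)] at this
    omega
  · intro l d hd ih hl
    obtain ⟨w, hw, i, hi, hlw⟩ := ih (refl_mem_lines hd hl)
    have hdd := inter_self_of_mem_simpleRoots hd
    have hQ : inter (toQ d) (toQ d) = -2 := by rw [inter_toQ, hdd]; norm_num
    refine ⟨reflEquiv (toQ d) hQ * w,
      mul_mem (Subgroup.subset_closure ⟨d, hd, fun D => rfl⟩) hw, i, hi, ?_⟩
    rw [LinearEquiv.mul_apply, ← hlw, reflEquiv_apply, ← toQ_refl, refl_refl hdd]
  · exact fun l' hl' => neg_one_le_inter hr hl hl'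

theorem gosset_eq (hr3 : 3 ≤ r) (hr : r ≤ 8) : gosset r = convexHull ℚ (toQ '' lines r) := by
  rw [gosset]
  congr 1
  ext x
  constructor
  · rintro ⟨w, hw, i, -, rfl⟩
    obtain ⟨l, hl, hwl⟩ := weylGroup_map_lines hw _ (e_mem_lines i)
    exact ⟨l, hl, hwl.symm⟩
  · rintro ⟨l, hl, rfl⟩
    exact exists_weylGroup_of_mem_lines hr3 hr hl

end DelPezzo

/-! ### Faces of convex hulls and vertices of simplexes -/

section Convex

variable {𝕜 E : Type*} [Field 𝕜] [LinearOrder 𝕜] [IsStrictOrderedRing 𝕜] [AddCommGroup E]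
  [Module 𝕜 E]

theorem sep_convexHull_eq {S : Set E} {φ : Module.Dual 𝕜 E} {c : 𝕜} (hS : ∀ s ∈ S, φ s ≤ c) :
    {x | x ∈ convexHull 𝕜 S ∧ φ x = c} = convexHull 𝕜 {s | s ∈ S ∧ φ s = c} := by
  apply Set.Subset.antisymm
  · have hface : ∀ x ∈ convexHull 𝕜 {s | s ∈ S ∧ φ s = c}, φ x = c := fun x hx =>
      convexHull_min (t := {x | φ x = c}) (fun s hs => hs.2)
        (convex_hyperplane φ.isLinear c) hx
    -- An open segment with an endpoint in the open half-space stays inside it, so its union with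
    -- the hull of the contact points is convex. It contains `S`, hence the whole hull.
    have hconv : Convex 𝕜 ({x | φ x < c} ∪ convexHull 𝕜 {s | s ∈ S ∧ φ s = c}) := by
      rw [convex_iff_openSegment_subset]
      rintro x hx y hy z ⟨a, b, ha, hb, hab, rfl⟩
      have hxc : φ x ≤ c := hx.elim le_of_lt fun h => (hface x h).le
      have hyc : φ y ≤ c := hy.elim le_of_lt fun h => (hface y h).le
      rcases hx with hx | hx
      · left
        simp only [Set.mem_ofPred_eq, map_add, map_smul, smul_eq_mul] at hx ⊢
        calc a * φ x + b * φ y < a * c + b * c :=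
              add_lt_add_of_lt_of_le (mul_lt_mul_of_pos_left hx ha)
                (mul_le_mul_of_nonneg_left hyc hb.le)
          _ = c := by rw [← add_mul, hab, one_mul]
      rcases hy with hy | hy
      · left
        simp only [Set.mem_ofPred_eq, map_add, map_smul, smul_eq_mul] at hy ⊢
        calc a * φ x + b * φ y < a * c + b * c :=
              add_lt_add_of_le_of_lt (mul_le_mul_of_nonneg_left hxc ha.le)
                (mul_lt_mul_of_pos_left hy hb)
          _ = c := by rw [← add_mul, hab, one_mul]
      · exact Or.inr (convex_convexHull 𝕜 _ hx hy ha.le hb.le hab)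
    rintro x ⟨hx, hxc⟩
    refine (convexHull_min (fun s hs => ?_) hconv hx).resolve_left (fun h => h.ne hxc)
    exact (hS s hs).lt_or_eq.imp id fun h => subset_convexHull 𝕜 _ ⟨hs, h⟩
  · exact fun x hx => ⟨convexHull_mono (fun s hs => hs.1) hx,
      convexHull_min (t := {x | φ x = c}) (fun s hs => hs.2) (convex_hyperplane φ.isLinear c) hx⟩

theorem isExtreme_sep_eq {P : Set E} {φ : Module.Dual 𝕜 E} {c : 𝕜} (hP : ∀ x ∈ P, φ x ≤ c) :
    IsExtreme 𝕜 P {x | x ∈ P ∧ φ x = c} := by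
  refine ⟨fun x hx => hx.1, ?_⟩
  rintro x hx y hy z ⟨-, hz⟩ ⟨a, b, ha, hb, hab, rfl⟩
  refine ⟨hx, le_antisymm (hP x hx) ?_⟩
  by_contra! hlt
  simp only [map_add, map_smul, smul_eq_mul] at hz
  have h1 : a * φ x < a * c := mul_lt_mul_of_pos_left hlt ha
  have h2 : b * φ y ≤ b * c := mul_le_mul_of_nonneg_left (hP y hy) hb.le
  have h3 : a * c + b * c = c := by rw [← add_mul, hab, one_mul]
  linarith

/-- The vertices of a simplex are its extreme points. -/
theorem AffineIndependent.extremePoints_convexHull_range {ι : Type*} {v : ι → E}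
    (hv : AffineIndependent 𝕜 v) : (convexHull 𝕜 (Set.range v)).extremePoints 𝕜 = Set.range v := by
  refine Set.Subset.antisymm extremePoints_convexHull_subset ?_
  rintro _ ⟨i, rfl⟩
  have hli := (affineIndependent_iff_linearIndependent_vsub 𝕜 v i).1 hv
  -- Affine independence allows prescribing `φ` on the edge vectors at `v i`, making `v i` the
  -- unique maximum.
  obtain ⟨φ, hφ⟩ : ∃ φ : Module.Dual 𝕜 E, ∀ j : {j // j ≠ i}, φ (v j - v i) = -1 := by
    obtain ⟨φ, hφ⟩ := LinearMap.exists_extend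
      ((Module.Basis.span hli).constr 𝕜 fun _ => (-1 : 𝕜))
    refine ⟨φ, fun j => ?_⟩
    have h1 := (Module.Basis.span hli).constr_basis 𝕜 (fun _ => (-1 : 𝕜)) j
    rw [← hφ, LinearMap.comp_apply, Submodule.subtype_apply, Module.Basis.span_apply] at h1
    exact h1
  have hlt : ∀ j, j ≠ i → φ (v j) < φ (v i) := fun j hj => by
    have := hφ ⟨j, hj⟩
    rw [map_sub] at this
    linarith
  have hle : ∀ s ∈ Set.range v, φ s ≤ φ (v i) := by
    rintro _ ⟨j, rfl⟩
    by_cases hj : j = i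
    · rw [hj]
    · exact (hlt j hj).le
  have hext := isExtreme_sep_eq (P := convexHull 𝕜 (Set.range v)) (φ := φ) (c := φ (v i))
    (fun x hx => convexHull_min (t := {x | φ x ≤ φ (v i)}) hle
      (convex_halfSpace_le φ.isLinear _) hx)
  have hsing : {s | s ∈ Set.range v ∧ φ s = φ (v i)} = {v i} := by
    ext s
    constructor
    · rintro ⟨⟨j, rfl⟩, hj⟩
      by_contra hne
      exact (hlt j fun h => hne (by rw [h]; rfl)).ne hj
    · rintro rfl
      exact ⟨⟨i, rfl⟩, rfl⟩
  rw [sep_convexHull_eq hle, hsing, convexHull_singleton] at hext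
  exact isExtreme_singleton.1 hext

end Convex

/-! ### Skew lines and faces of the polytope -/

namespace DelPezzo

variable {r a : ℕ}

theorem IsFace.isExtreme {P F : Set (PicQ r)} (hF : IsFace P F) : IsExtreme ℚ P F := by
  obtain ⟨-, φ, c, hP, rfl⟩ := hF
  exact isExtreme_sep_eq hP

theorem toQ_mem_gosset (hr3 : 3 ≤ r) (hr : r ≤ 8) {l : Pic r} (hl : l ∈ lines r) :
    toQ l ∈ gosset r := by
  rw [gosset_eq hr3 hr]
  exact subset_convexHull ℚ _ ⟨l, hl, rfl⟩

theorem inter_sum_eq_neg_one {l : Fin a → Pic r} (hl : ∀ i, l i ∈ lines r)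
    (hskew : ∀ i j, i ≠ j → inter (l i) (l j) = 0) (j : Fin a) :
    inter (l j) (∑ i, l i) = -1 := by
  rw [inter_sum_right, Finset.sum_eq_single j (fun i _ hi => hskew j i hi.symm) (by simp)]
  exact (hl j).1

theorem inter_sum_nonneg (hr : r ≤ 8) {l : Fin a → Pic r} (hl : ∀ i, l i ∈ lines r)
    {x : Pic r} (hx : x ∈ lines r) (hxl : x ∉ Set.range l) : 0 ≤ inter x (∑ i, l i) := by
  rw [inter_sum_right]
  exact Finset.sum_nonneg fun i _ =>
    inter_nonneg_of_ne hr hx (hl i) fun hh => hxl ⟨i, hh.symm⟩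

/-- The members of a set of pairwise skew lines are recovered from their sum. -/
theorem mem_range_iff_inter_sum (hr : r ≤ 8) {l : Fin a → Pic r} (hl : ∀ i, l i ∈ lines r)
    (hskew : ∀ i j, i ≠ j → inter (l i) (l j) = 0) {x : Pic r} (hx : x ∈ lines r) :
    x ∈ Set.range l ↔ inter x (∑ i, l i) = -1 := by
  constructor
  · rintro ⟨j, rfl⟩
    exact inter_sum_eq_neg_one hl hskew j
  · intro hh
    by_contra hxl
    have := inter_sum_nonneg hr hl hx hxl
    omega

theorem affineIndependent_of_skew {l : Fin a → Pic r} (hl : ∀ i, l i ∈ lines r)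
    (hskew : ∀ i j, i ≠ j → inter (l i) (l j) = 0) :
    AffineIndependent ℚ fun i => toQ (l i) := by
  apply LinearIndependent.affineIndependent
  rw [Fintype.linearIndependent_iff]
  intro g hg j
  have h1 : inter (∑ i, g i • toQ (l i)) (toQ (l j)) = 0 := by
    rw [hg]; exact map_zero (interLeft (toQ (l j)))
  rw [inter_sum_left, Finset.sum_eq_single j _ (by simp), inter_smul_left, inter_toQ,
    (hl j).1] at h1
  · simpa using h1
  · intro i _ hi
    rw [inter_smul_left, inter_toQ, hskew i j hi, Int.cast_zero, mul_zero]

theorem isFace_convexHull_of_skew (hr3 : 3 ≤ r) (hr : r ≤ 8) (ha : 1 ≤ a) {l : Fin a → Pic r}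
    (hl : ∀ i, l i ∈ lines r) (hskew : ∀ i j, i ≠ j → inter (l i) (l j) = 0) :
    IsFace (gosset r) (convexHull ℚ (Set.range fun i => toQ (l i))) := by
  have hφ : ∀ x : Pic r, (-interLeft (toQ (∑ i, l i))) (toQ x) = ((-inter x (∑ i, l i) : ℤ) : ℚ) :=
    fun x => by rw [LinearMap.neg_apply, interLeft_apply, inter_toQ, Int.cast_neg]
  have hle : ∀ s ∈ toQ '' lines r, (-interLeft (toQ (∑ i, l i))) s ≤ 1 := by
    rintro _ ⟨x, hx, rfl⟩
    rw [hφ]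
    by_cases hxl : x ∈ Set.range l
    · rw [(mem_range_iff_inter_sum hr hl hskew hx).1 hxl]; norm_num
    · have := inter_sum_nonneg hr hl hx hxl
      exact_mod_cast (by omega : -inter x (∑ i, l i) ≤ 1)
  refine ⟨⟨_, subset_convexHull ℚ _ ⟨⟨0, ha⟩, rfl⟩⟩, -interLeft (toQ (∑ i, l i)), 1, ?_, ?_⟩
  · rw [gosset_eq hr3 hr]
    exact fun x hx => convexHull_min (t := {x | (-interLeft (toQ (∑ i, l i))) x ≤ 1}) hle
      (convex_halfSpace_le (LinearMap.isLinear _) _) hx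
  · rw [gosset_eq hr3 hr, sep_convexHull_eq hle]
    congr 1
    ext s
    constructor
    · rintro ⟨i, rfl⟩
      refine ⟨⟨l i, hl i, rfl⟩, ?_⟩
      rw [hφ, inter_sum_eq_neg_one hl hskew]; norm_num
    · rintro ⟨⟨x, hx, rfl⟩, hs⟩
      rw [hφ] at hs
      have hs' : -inter x (∑ i, l i) = 1 := by exact_mod_cast hs
      obtain ⟨i, rfl⟩ := (mem_range_iff_inter_sum hr hl hskew hx).2 (by omega)
      exact ⟨i, rfl⟩

theorem extremePoints_gosset (hr3 : 3 ≤ r) (hr : r ≤ 8) :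
    (gosset r).extremePoints ℚ = toQ '' lines r := by
  apply Set.Subset.antisymm
  · rw [gosset_eq hr3 hr]
    exact extremePoints_convexHull_subset
  · rintro _ ⟨l, hl, rfl⟩
    -- A single line is a skew family with `a = 1`, so its point is a face.
    have := (isFace_convexHull_of_skew (a := 1) hr3 hr le_rfl (l := fun _ => l) (fun _ => hl)
      fun i j hij => absurd (Subsingleton.elim i j) hij).isExtreme
    rw [Set.range_const, convexHull_singleton] at this
    exact isExtreme_singleton.1 this

/-- The vertices of a face of the polytope are the lines it contains. -/
theorem extremePoints_face (hr3 : 3 ≤ r) (hr : r ≤ 8) {F : Set (PicQ r)}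
    (hF : IsFace (gosset r) F) : F.extremePoints ℚ = F ∩ toQ '' lines r := by
  rw [hF.isExtreme.extremePoints_eq, extremePoints_gosset hr3 hr]

/-- The values of `φ` at `x` and `y` are at most `c` and sum to `2c`. -/
theorem IsFace.mem_of_add_eq {P F : Set (PicQ r)} (hF : IsFace P F) {u v x y : PicQ r}
    (hu : u ∈ F) (hv : v ∈ F) (hx : x ∈ P) (hy : y ∈ P) (hxy : x + y = u + v) : x ∈ F := by
  obtain ⟨-, φ, c, hP, rfl⟩ := hF
  have h1 := congrArg φ hxy
  rw [map_add, map_add, hu.2, hv.2] at h1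
  exact ⟨hx, le_antisymm (hP x hx) (by linarith [hP y hy])⟩

theorem isFace_segment_iff (hr3 : 3 ≤ r) (hr : r ≤ 8) {l₁ l₂ : Pic r} (h₁ : l₁ ∈ lines r)
    (h₂ : l₂ ∈ lines r) (hne : l₁ ≠ l₂) :
    IsFace (gosset r) (segment ℚ (toQ l₁) (toQ l₂)) ↔ inter l₁ l₂ = 0 := by
  constructor
  · intro hF
    by_contra h0
    obtain ⟨x, hx, y, hy, hxy, hx₁, hx₂, -, -⟩ := exists_add_eq_add hr3 hr h₁ h₂
      (lt_of_le_of_ne (inter_nonneg_of_ne hr h₁ h₂ hne) (Ne.symm h0))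
    have hxF := hF.mem_of_add_eq (left_mem_segment ℚ _ _) (right_mem_segment ℚ _ _)
      (toQ_mem_gosset hr3 hr hx) (toQ_mem_gosset hr3 hr hy) (by rw [← toQ_add, hxy, toQ_add])
    have hxe : toQ x ∈ (segment ℚ (toQ l₁) (toQ l₂)).extremePoints ℚ := by
      rw [extremePoints_face hr3 hr hF]
      exact ⟨hxF, x, hx, rfl⟩
    rw [← convexHull_pair] at hxe
    rcases extremePoints_convexHull_subset hxe with hh | hh
    · exact hx₁ (toQ_injective hh)
    · exact hx₂ (toQ_injective hh)
  · intro h0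
    have := isFace_convexHull_of_skew (a := 2) hr3 hr (by norm_num) (l := ![l₁, l₂])
      (by simp [Fin.forall_fin_two, h₁, h₂])
      (by simp [Fin.forall_fin_two, h0, inter_comm l₂ l₁])
    have hrange : (Set.range fun i => toQ (![l₁, l₂] i)) = {toQ l₁, toQ l₂} := by
      ext s
      simp [Fin.exists_fin_two, eq_comm]
    rwa [hrange, convexHull_pair] at this

/-- A simplex face is spanned by pairwise skew lines. -/
theorem exists_skew_of_mem_simplexFaces (hr3 : 3 ≤ r) (hr : r ≤ 8) {F : Set (PicQ r)}
    (hF : F ∈ simplexFaces r a) : ∃ l : Fin a → Pic r, (∀ i, l i ∈ lines r) ∧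
      (∀ i j, i ≠ j → inter (l i) (l j) = 0) ∧
      F = convexHull ℚ (Set.range fun i => toQ (l i)) := by
  obtain ⟨hface, v, hv, hFv⟩ := hF
  have hext : F.extremePoints ℚ = Set.range v := by
    rw [hFv, hv.extremePoints_convexHull_range]
  have hext' := extremePoints_face hr3 hr hface
  have hmem : ∀ i, v i ∈ F ∩ toQ '' lines r := fun i => by
    rw [← hext', hext]; exact ⟨i, rfl⟩
  choose l hl hlv using fun i => (hmem i).2
  obtain rfl : (fun i => toQ (l i)) = v := funext hlv
  refine ⟨l, hl, fun i j hij => ?_, hFv⟩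
  have hne : l i ≠ l j := fun hh => hij (hv.injective (congrArg toQ hh))
  by_contra h0
  obtain ⟨x, hx, y, hy, hxy, hxi, hxj, hyi, hyj⟩ := exists_add_eq_add hr3 hr (hl i) (hl j)
    (lt_of_le_of_ne (inter_nonneg_of_ne hr (hl i) (hl j) hne) (Ne.symm h0))
  have hsum : toQ x + toQ y = toQ (l i) + toQ (l j) := by rw [← toQ_add, hxy, toQ_add]
  have hidx : ∀ z ∈ lines r, toQ z ∈ F → ∃ m, l m = z := fun z hz hzF => by
    obtain ⟨m, hm⟩ : toQ z ∈ Set.range fun i => toQ (l i) := by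
      rw [← hext, hext']; exact ⟨hzF, z, hz, rfl⟩
    exact ⟨m, toQ_injective hm⟩
  obtain ⟨m, rfl⟩ := hidx x hx (hface.mem_of_add_eq (hmem i).1 (hmem j).1
    (toQ_mem_gosset hr3 hr hx) (toQ_mem_gosset hr3 hr hy) hsum)
  obtain ⟨n, rfl⟩ := hidx y hy (hface.mem_of_add_eq (hmem i).1 (hmem j).1
    (toQ_mem_gosset hr3 hr hy) (toQ_mem_gosset hr3 hr hx) (by rw [add_comm, hsum]))
  -- Both pairs of vertices have the same midpoint, but disjoint sets of vertices of a simplex have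
  -- disjoint affine spans.
  have hdisj : Disjoint ({i, j} : Set (Fin a)) {m, n} := by
    rw [Set.disjoint_left]
    rintro k (rfl | rfl) (rfl | rfl) <;> contradiction
  have hmid : ∀ s t : Fin a, midpoint ℚ (toQ (l s)) (toQ (l t)) ∈
      affineSpan ℚ ((fun i => toQ (l i)) '' {s, t}) := fun s t => by
    rw [Set.image_pair]
    exact AffineMap.lineMap_mem_affineSpan_pair _ _ _
  refine Set.disjoint_left.1 (hv.affineSpan_disjoint_of_disjoint hdisj) (hmid i j) ?_
  have heq : midpoint ℚ (toQ (l i)) (toQ (l j)) = midpoint ℚ (toQ (l m)) (toQ (l n)) := by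
    rw [midpoint_eq_smul_add, midpoint_eq_smul_add, hsum]
  rw [heq]
  exact hmid m n

/-! ### Vertex sums and skew `a`-lines -/

theorem extremePoints_convexHull_of_skew {l : Fin a → Pic r} (hl : ∀ i, l i ∈ lines r)
    (hskew : ∀ i j, i ≠ j → inter (l i) (l j) = 0) :
    (convexHull ℚ (Set.range fun i => toQ (l i))).extremePoints ℚ =
      Set.range fun i => toQ (l i) :=
  (affineIndependent_of_skew hl hskew).extremePoints_convexHull_range

theorem vertexSum_convexHull_of_skew {l : Fin a → Pic r} (hl : ∀ i, l i ∈ lines r)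
    (hskew : ∀ i j, i ≠ j → inter (l i) (l j) = 0) :
    vertexSum (convexHull ℚ (Set.range fun i => toQ (l i))) = toQ (∑ i, l i) := by
  rw [vertexSum, extremePoints_convexHull_of_skew hl hskew,
    finsum_mem_range (affineIndependent_of_skew hl hskew).injective, finsum_eq_sum_of_fintype,
    toQ_sum]

theorem injOn_vertexSum (hr3 : 3 ≤ r) (hr : r ≤ 8) :
    Set.InjOn (vertexSum : Set (PicQ r) → PicQ r) (simplexFaces r a) := by
  intro F hF F' hF' hFF'
  obtain ⟨l, hl, hskew, rfl⟩ := exists_skew_of_mem_simplexFaces hr3 hr hF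
  obtain ⟨l', hl', hskew', rfl⟩ := exists_skew_of_mem_simplexFaces hr3 hr hF'
  rw [vertexSum_convexHull_of_skew hl hskew, vertexSum_convexHull_of_skew hl' hskew'] at hFF'
  have hsum := toQ_injective hFF'
  -- A line is a summand exactly when it pairs to `-1` with the sum, so equal sums have the same
  -- summands.
  have hrange : Set.range l = Set.range l' := by
    ext x
    constructor
    · rintro ⟨i, rfl⟩
      rw [mem_range_iff_inter_sum hr hl' hskew' (hl i), ← hsum]
      exact inter_sum_eq_neg_one hl hskew i
    · rintro ⟨i, rfl⟩
      rw [mem_range_iff_inter_sum hr hl hskew (hl' i), hsum]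
      exact inter_sum_eq_neg_one hl' hskew' i
  have hcomp : ∀ f : Fin a → Pic r, (Set.range fun i => toQ (f i)) = toQ '' Set.range f :=
    fun f => Set.range_comp toQ f
  rw [hcomp, hcomp, hrange]

theorem inter_sub_self_of_simplexFace (hr3 : 3 ≤ r) (hr : r ≤ 8) {F : Set (PicQ r)}
    (hF : F ∈ simplexFaces r a) {u v : PicQ r} (hu : u ∈ F.extremePoints ℚ)
    (hv : v ∈ F.extremePoints ℚ) (hne : u ≠ v) : inter (u - v) (u - v) = -2 := by
  obtain ⟨l, hl, hskew, rfl⟩ := exists_skew_of_mem_simplexFaces hr3 hr hF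
  rw [extremePoints_convexHull_of_skew hl hskew] at hu hv
  obtain ⟨i, rfl⟩ := hu
  obtain ⟨j, rfl⟩ := hv
  have hij : i ≠ j := fun hh => hne (by rw [hh])
  rw [inter_sub_left, inter_sub_right, inter_sub_right, inter_toQ, inter_toQ, inter_toQ,
    inter_toQ, (hl i).1, (hl j).1, hskew i j hij, hskew j i hij.symm]
  norm_num

theorem exists_equiv_skewLines (hr3 : 3 ≤ r) (hr : r ≤ 8) (ha : 1 ≤ a) :
    ∃ Φ : simplexFaces r a ≃ skewLines r a, ∀ F : simplexFaces r a,
      toQ (Φ F : Pic r) = vertexSum (F : Set (PicQ r)) := by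
  have hex : ∀ F : simplexFaces r a, ∃ D : skewLines r a,
      toQ (D : Pic r) = vertexSum (F : Set (PicQ r)) := by
    rintro ⟨F, hF⟩
    obtain ⟨l, hl, hskew, rfl⟩ := exists_skew_of_mem_simplexFaces hr3 hr hF
    exact ⟨⟨∑ i, l i, l, hl, hskew, rfl⟩, (vertexSum_convexHull_of_skew hl hskew).symm⟩
  choose Φ hΦ using hex
  refine ⟨Equiv.ofBijective Φ ⟨fun F F' hFF' => ?_, ?_⟩, hΦ⟩
  · exact Subtype.ext (injOn_vertexSum hr3 hr F.2 F'.2 (by rw [← hΦ, ← hΦ, hFF']))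
  · rintro ⟨D, l, hl, hskew, rfl⟩
    refine ⟨⟨convexHull ℚ (Set.range fun i => toQ (l i)),
      isFace_convexHull_of_skew hr3 hr ha hl hskew, _, affineIndependent_of_skew hl hskew, rfl⟩,
      Subtype.ext (toQ_injective ?_)⟩
    rw [hΦ, vertexSum_convexHull_of_skew hl hskew]

end DelPezzo

theorem mainTheorem2 (r : ℕ) (hr3 : 3 ≤ r) (hr8 : r ≤ 8) :
    -- the vertices of the polytope are the lines
    (DelPezzo.gosset r).extremePoints ℚ = DelPezzo.toQ '' DelPezzo.lines r ∧
    -- two vertices are joined by an edge iff the lines have intersection `0`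
    (∀ l₁ ∈ DelPezzo.lines r, ∀ l₂ ∈ DelPezzo.lines r, l₁ ≠ l₂ →
      (DelPezzo.IsFace (DelPezzo.gosset r) (segment ℚ (DelPezzo.toQ l₁) (DelPezzo.toQ l₂)) ↔
        DelPezzo.inter l₁ l₂ = 0)) ∧
    ∀ a : ℕ, 1 ≤ a → a ≤ r →
      -- the simplex faces are regular, of edge length squared `-2` in the intersection form
      (∀ F ∈ DelPezzo.simplexFaces r a, ∀ u ∈ F.extremePoints ℚ, ∀ v ∈ F.extremePoints ℚ,
        u ≠ v → DelPezzo.inter (u - v) (u - v) = -2) ∧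
      -- distinct simplex faces have distinct centers
      Set.InjOn DelPezzo.vertexSum (DelPezzo.simplexFaces r a) ∧
      -- the sum of the vertices is a bijection onto the skew `a`-lines
      ∃ Φ : DelPezzo.simplexFaces r a ≃ DelPezzo.skewLines r a,
        ∀ F : DelPezzo.simplexFaces r a,
          DelPezzo.toQ (Φ F : DelPezzo.Pic r) = DelPezzo.vertexSum (F : Set (DelPezzo.PicQ r)) := by
  refine ⟨DelPezzo.extremePoints_gosset hr3 hr8,
    fun l₁ h₁ l₂ h₂ hne => DelPezzo.isFace_segment_iff hr3 hr8 h₁ h₂ hne, fun a ha _ => ?_⟩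
  exact ⟨fun F hF u hu v hv hne =>
    DelPezzo.inter_sub_self_of_simplexFace hr3 hr8 hF hu hv hne,
    DelPezzo.injOn_vertexSum hr3 hr8, DelPezzo.exists_equiv_skewLines hr3 hr8 ha⟩
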